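/- Let $G\rightrightarrows M$ be a (finite-dimensional, real) Lie groupoid with source $s$, target $t$ and product $g_2g_1$ defined when $s(g_2)=t(g_1)$, and let $G^{(2)}$ be the manifold of composable pairs $(g_2,g_1)$. A 2-cocycle is a smooth function $S:G^{(2)}\to\mathbb{R}$ with $$S(g_2,g_1)-S(g_3g_2,g_1)+S(g_3,g_2g_1)-S(g_3,g_2)=0$$ for all composable triples. Let $A\to M$ be the Lie algebroid of $G$, with fibre $A_m=\ker(dt)$ at the unit $1_m$. For $X\in\Gamma(A)$ put $(R_XS)(g)=X\cdot S(g,\,\cdot\,)$ at $1_{s(g)}$ (derivative along the fibre $t^{-1}(s(g))$) and, for $f\in C^\infty(G)$, $(R_Xf)(m)=X\cdot f$ at $1_m$. The van Est map on 2-cochains is $$VE(S)(X_1,X_2)=\sum_{\sigma\in S_2}\mathrm{sgn}(\sigma)\,R_{X_{\sigma(2)}}R_{X_{\sigma(1)}}S .$$ Let $\Pi$ be a 2-form on $A$ (for instance the Poisson bivector, when $G$ integrates a Poisson manifold $(M,\Pi)$, so that $A\cong T^*M$). If $S$ is a 2-cocycle on $G$ with $VE(S)=\Pi$ and $$\tilde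 S(g_2,g_1)=\frac{S(g_2,g_1)-S(g_1^{-1},g_2^{-1})}{2},$$ then: 1. $\tilde S$ is a 2-cocycle; 2. $VE(\tilde S)=\Pi$; 3. $\tilde S(g_2,g_1)=-\tilde S(g_1^{-1},g_2^{-1})$ for all composable $(g_2,g_1)$; 4. complex conjugation is an involution for the product defined by $\tilde S$. Precisely: let $\hbar\neq 0$ be real, let $\mu_m$ be an s-finite measure on $s^{-1}(m)$ for each $m\in M$, let $\mu^m$ be its image on $t^{-1}(m)$ under inversion, and for $f,g:M\to\mathbb{C}$ set $$(f\star g)(m)=\frac1{C_m}\int_{s^{-1}(m)\times t^{-1}(m)}f(t(g_2))\,g(s(g_1))\,e^{\frac{i}{\hbar}\tilde S(g_2,g_1)}\,d\mu_m(g_2)\,d\mu^m(g_1),\qquad C_m=\int_{s^{-1}(m)\times t^{-1}(m)}e^{\frac{i}{\hbar}\tilde S}\,d\mu_m\,d\mu^m ,$$ where the integrals are improper integrals, taken along a given increasing sequence of measurable regions which exhaust $s^{-1}(m)\times t^{-1}(m)$ and are invariant under $(g_2,g_1)\mapsto(g_1^{-1},g_2^{-1})$ (for absolutely convergent integrals the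 one region $s^{-1}(m)\times t^{-1}(m)$ may be used). Then $f\mapsto\bar f$ is conjugate-linear and involutive and, whenever $(f\star g)(m)$ is defined (the integrals converge and $C_m\ne0$), so is $(\bar g\star\bar f)(m)$, and $$\overline{(f\star g)(m)}=(\bar g\star\bar f)(m).$$ -/

import Mathlib

open scoped Manifold ContDiff Topology ComplexConjugate
open MeasureTheory Filter

noncomputable section

/-- `F : X → N` restricts to a smooth map on the (embedded) submanifold `A` of `X`: near each point
of `A` it agrees on `A` with a smooth map defined on an open subset of `X`.  The values of `F`
outside `A` are irrelevant. -/
def SmoothOnSubmanifold {EX HX EN HN X N : Type*}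
    [NormedAddCommGroup EX] [NormedSpace ℝ EX] [TopologicalSpace HX]
    (I : ModelWithCorners ℝ EX HX)
    [NormedAddCommGroup EN] [NormedSpace ℝ EN] [TopologicalSpace HN]
    (J : ModelWithCorners ℝ EN HN)
    [TopologicalSpace X] [ChartedSpace HX X] [TopologicalSpace N] [ChartedSpace HN N]
    (A : Set X) (F : X → N) : Prop :=
  ∀ p ∈ A, ∃ (U : Set X) (F' : X → N),
    IsOpen U ∧ p ∈ U ∧ ContMDiffOn I J ∞ F' U ∧ ∀ q ∈ U ∩ A, F' q = F q

/-- A Lie groupoid `G ⇉ M`, where `G` is the manifold of arrows (modelled on `EG`) and `M` the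
manifold of objects (modelled on `EM`).  The product `mul g₂ g₁` is meaningful only for composable
pairs, `src g₂ = tgt g₁`; no law involves its values on other pairs. -/
structure LieGroupoid (EM EG M G : Type*)
    [NormedAddCommGroup EM] [NormedSpace ℝ EM] [NormedAddCommGroup EG] [NormedSpace ℝ EG]
    [TopologicalSpace M] [ChartedSpace EM M] [TopologicalSpace G] [ChartedSpace EG G] where
  src : G → M
  tgt : G → M
  unit : M → G
  inv : G → G
  mul : G → G → G
  src_unit : ∀ m, src (unit m) = m
  tgt_unit : ∀ m, tgt (unit m) = m
  src_inv : ∀ g, src (inv g) = tgt g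
  tgt_inv : ∀ g, tgt (inv g) = src g
  src_mul : ∀ g₂ g₁, src g₂ = tgt g₁ → src (mul g₂ g₁) = src g₁
  tgt_mul : ∀ g₂ g₁, src g₂ = tgt g₁ → tgt (mul g₂ g₁) = tgt g₂
  mul_assoc : ∀ g₃ g₂ g₁, src g₃ = tgt g₂ → src g₂ = tgt g₁ →
    mul (mul g₃ g₂) g₁ = mul g₃ (mul g₂ g₁)
  unit_mul : ∀ g, mul (unit (tgt g)) g = g
  mul_unit : ∀ g, mul g (unit (src g)) = g
  inv_mul : ∀ g, mul (inv g) g = unit (src g)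
  mul_inv : ∀ g, mul g (inv g) = unit (tgt g)
  submersion_src : Manifold.IsSubmersion 𝓘(ℝ, EG) 𝓘(ℝ, EM) ∞ src
  submersion_tgt : Manifold.IsSubmersion 𝓘(ℝ, EG) 𝓘(ℝ, EM) ∞ tgt
  smooth_unit : ContMDiff 𝓘(ℝ, EM) 𝓘(ℝ, EG) ∞ unit
  smooth_inv : ContMDiff 𝓘(ℝ, EG) 𝓘(ℝ, EG) ∞ inv
  smooth_mul : SmoothOnSubmanifold (𝓘(ℝ, EG).prod 𝓘(ℝ, EG)) 𝓘(ℝ, EG)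
    {p : G × G | src p.1 = tgt p.2} (fun p => mul p.1 p.2)

namespace LieGroupoid

variable {EM EG M G : Type*}
    [NormedAddCommGroup EM] [NormedSpace ℝ EM] [NormedAddCommGroup EG] [NormedSpace ℝ EG]
    [TopologicalSpace M] [ChartedSpace EM M] [TopologicalSpace G] [ChartedSpace EG G]

/-! ### Groupoid cochains -/

/-- `S`, restricted to composable pairs, is a smooth real 2-cochain: `S ∈ C^∞(G⁽²⁾)`. -/
def IsSmoothCochain (Γ : LieGroupoid EM EG M G) (S : G → G → ℝ) : Prop :=
  SmoothOnSubmanifold (𝓘(ℝ, EG).prod 𝓘(ℝ, EG)) 𝓘(ℝ, ℝ)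
    {p : G × G | Γ.src p.1 = Γ.tgt p.2} (fun p => S p.1 p.2)

/-- The groupoid differential `δ^* S = d₀^* S - d₁^* S + d₂^* S - d₃^* S` of a 2-cochain, at a
composable triple `(g₃, g₂, g₁)`. -/
def delta (Γ : LieGroupoid EM EG M G) (S : G → G → ℝ) (g₃ g₂ g₁ : G) : ℝ :=
  S g₂ g₁ - S (Γ.mul g₃ g₂) g₁ + S g₃ (Γ.mul g₂ g₁) - S g₃ g₂

/-- `S` is a (smooth, real-valued) groupoid 2-cocycle. -/
def IsCocycle (Γ : LieGroupoid EM EG M G) (S : G → G → ℝ) : Prop :=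
  Γ.IsSmoothCochain S ∧
    ∀ g₃ g₂ g₁, Γ.src g₃ = Γ.tgt g₂ → Γ.src g₂ = Γ.tgt g₁ → Γ.delta S g₃ g₂ g₁ = 0

/-- The antisymmetrization `S̃(g₂, g₁) = (S(g₂, g₁) - S(g₁⁻¹, g₂⁻¹)) / 2`. -/
def antisymm (Γ : LieGroupoid EM EG M G) (S : G → G → ℝ) (g₂ g₁ : G) : ℝ :=
  (S g₂ g₁ - S (Γ.inv g₁) (Γ.inv g₂)) / 2

/-! ### The Lie algebroid and the van Est map -/

/-- The fibre at `m` of the Lie algebroid of `Γ`: the vectors at the unit `unit m` that are tangent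
to the target fibre `tgt⁻¹(m)`. -/
def Algebroid (Γ : LieGroupoid EM EG M G) (m : M) :
    Submodule ℝ (TangentSpace 𝓘(ℝ, EG) (Γ.unit m)) :=
  LinearMap.ker (mfderiv 𝓘(ℝ, EG) 𝓘(ℝ, EM) Γ.tgt (Γ.unit m)).toLinearMap

/-- A smooth section of the Lie algebroid. -/
structure AlgebroidSection [IsManifold 𝓘(ℝ, EG) ∞ G] (Γ : LieGroupoid EM EG M G) where
  toFun : ∀ m, Γ.Algebroid m
  smooth : ContMDiff 𝓘(ℝ, EM) 𝓘(ℝ, EG).tangent ∞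
    (fun m => (⟨Γ.unit m, (toFun m : TangentSpace 𝓘(ℝ, EG) (Γ.unit m))⟩ :
      TangentBundle 𝓘(ℝ, EG) G))

/-- A 2-form on the Lie algebroid: an alternating bilinear form on each fibre. -/
abbrev AlgebroidTwoForm (Γ : LieGroupoid EM EG M G) :=
  ∀ m, (Γ.Algebroid m) [⋀^Fin 2]→ₗ[ℝ] ℝ

/-- `R_X` on 2-cochains: `(R_X S)(g) = X · S(g, ·)` at the unit of `s(g)`, the derivative being
taken along the target fibre `{h | t(h) = s(g)}` on which `S(g, ·)` is defined.  As `X` is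
tangent to that fibre, the value does not depend on `S` outside composable pairs. -/
def RTwo [IsManifold 𝓘(ℝ, EG) ∞ G] (Γ : LieGroupoid EM EG M G) (X : Γ.AlgebroidSection) (S : G → G → ℝ) (g : G) : ℝ :=
  mfderivWithin 𝓘(ℝ, EG) 𝓘(ℝ, ℝ) (fun h => S g h) {h | Γ.tgt h = Γ.src g}
    (Γ.unit (Γ.src g)) (X.toFun (Γ.src g) : TangentSpace 𝓘(ℝ, EG) (Γ.unit (Γ.src g)))

/-- `R_X` on 1-cochains: `(R_X f)(m) = X · f` at the unit of `m`. -/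
def ROne [IsManifold 𝓘(ℝ, EG) ∞ G] (Γ : LieGroupoid EM EG M G) (X : Γ.AlgebroidSection) (f : G → ℝ) (m : M) : ℝ :=
  mfderiv 𝓘(ℝ, EG) 𝓘(ℝ, ℝ) f (Γ.unit m) (X.toFun m : TangentSpace 𝓘(ℝ, EG) (Γ.unit m))

/-- The van Est map in degree 2, at the level of cochains:
`VE(S)(X₁, X₂) = ∑_σ sgn(σ) R_{X_σ(2)} R_{X_σ(1)} S`. -/
def VE [IsManifold 𝓘(ℝ, EG) ∞ G] (Γ : LieGroupoid EM EG M G) (S : G → G → ℝ)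
    (X : Fin 2 → Γ.AlgebroidSection) (m : M) : ℝ :=
  ∑ σ : Equiv.Perm (Fin 2),
    ((Equiv.Perm.sign σ : ℤ) : ℝ) * Γ.ROne (X (σ 1)) (Γ.RTwo (X (σ 0)) S) m

/-- `VE(S) = Π`, as 2-forms on the Lie algebroid. -/
def VanEstEq [IsManifold 𝓘(ℝ, EG) ∞ G] (Γ : LieGroupoid EM EG M G) (S : G → G → ℝ)
    (P : Γ.AlgebroidTwoForm) : Prop :=
  ∀ (X : Fin 2 → Γ.AlgebroidSection) (m : M), Γ.VE S X m = P m (fun i => (X i).toFun m)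

/-! ### The product and its involution -/

/-- The source fibre `s⁻¹(m)`. -/
abbrev SrcFiber (Γ : LieGroupoid EM EG M G) (m : M) := {g : G // Γ.src g = m}

/-- The target fibre `t⁻¹(m)`. -/
abbrev TgtFiber (Γ : LieGroupoid EM EG M G) (m : M) := {g : G // Γ.tgt g = m}

/-- Inversion, as a map `s⁻¹(m) → t⁻¹(m)`. -/
def invFiber (Γ : LieGroupoid EM EG M G) (m : M) (g : Γ.SrcFiber m) : Γ.TgtFiber m :=
  ⟨Γ.inv g.1, (Γ.tgt_inv g.1).trans g.2⟩

/-- `(g₂, g₁) ↦ (g₁⁻¹, g₂⁻¹)`, on composable pairs meeting at `m`. -/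
def reversal (Γ : LieGroupoid EM EG M G) (m : M) (p : Γ.SrcFiber m × Γ.TgtFiber m) :
    Γ.SrcFiber m × Γ.TgtFiber m :=
  (⟨Γ.inv p.2.1, (Γ.src_inv p.2.1).trans p.2.2⟩, ⟨Γ.inv p.1.1, (Γ.tgt_inv p.1.1).trans p.1.2⟩)

/-- The measure on `s⁻¹(m) × t⁻¹(m)` determined by a measure `μ m` on `s⁻¹(m)`: the product of
`μ m` with its image on `t⁻¹(m)` under inversion. -/
def pairMeasure [MeasurableSpace G] (Γ : LieGroupoid EM EG M G)
    (μ : ∀ m, Measure (Γ.SrcFiber m)) (m : M) : Measure (Γ.SrcFiber m × Γ.TgtFiber m) :=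
  (μ m).prod ((μ m).map (Γ.invFiber m))

/-- An exhaustion of `s⁻¹(m) × t⁻¹(m)` by regions that are symmetric under reversal of arrows, such
as the regions `K_n × K_n⁻¹` for an exhaustion `K_n` of `s⁻¹(m)`.  The constant exhaustion by the
whole space is allowed. -/
structure Exhaustion [MeasurableSpace G] (Γ : LieGroupoid EM EG M G) (m : M) where
  region : ℕ → Set (Γ.SrcFiber m × Γ.TgtFiber m)
  measurable : ∀ n, MeasurableSet (region n)
  mono : Monotone region
  exhausts : ⋃ n, region n = Set.univ
  symmetric : ∀ n p, p ∈ region n → Γ.reversal m p ∈ region n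

/-- The improper integral of `F` over `s⁻¹(m) × t⁻¹(m)` along the exhaustion `D` converges to `c`. -/
def HasImproperIntegral [MeasurableSpace G] (Γ : LieGroupoid EM EG M G)
    (μ : ∀ m, Measure (Γ.SrcFiber m)) {m : M} (D : Γ.Exhaustion m)
    (F : Γ.SrcFiber m × Γ.TgtFiber m → ℂ) (c : ℂ) : Prop :=
  (∀ n, IntegrableOn F (D.region n) (Γ.pairMeasure μ m)) ∧
    Tendsto (fun n => ∫ p in D.region n, F p ∂(Γ.pairMeasure μ m)) atTop (𝓝 c)

/-- `(f ⋆ g)(m)` is defined and equal to `v`, where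
`(f ⋆ g)(m) = (1 / C_m) ∫_{s⁻¹(m) × t⁻¹(m)} f(t(g₂)) g(s(g₁)) exp((i/ħ) S(g₂, g₁))` and
`C_m = ∫_{s⁻¹(m) × t⁻¹(m)} exp((i/ħ) S(g₂, g₁)) ≠ 0`. -/
def HasStar [MeasurableSpace G] (Γ : LieGroupoid EM EG M G) (S : G → G → ℝ) (hbar : ℝ)
    (μ : ∀ m, Measure (Γ.SrcFiber m)) (D : ∀ m, Γ.Exhaustion m)
    (f g : M → ℂ) (m : M) (v : ℂ) : Prop :=
  ∃ C c : ℂ, C ≠ 0 ∧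
    Γ.HasImproperIntegral μ (D m)
      (fun p => Complex.exp (Complex.I / (hbar : ℂ) * (S p.1.1 p.2.1 : ℂ))) C ∧
    Γ.HasImproperIntegral μ (D m)
      (fun p => f (Γ.tgt p.1.1) * g (Γ.src p.2.1) *
        Complex.exp (Complex.I / (hbar : ℂ) * (S p.1.1 p.2.1 : ℂ))) c ∧
    v = 1 / C * c

end LieGroupoid

/-- `J` is a conjugate-linear involution, reversing products, for the partially defined product
`star` on complex functions; `star f g m (k m)` says that `f ⋆ g` is defined at the point `m` and
agrees there with `k`.  Thus `anti_mul` is `J (f ⋆ g) = J g ⋆ J f`, at each point where `f ⋆ g` is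
defined. -/
structure IsConjInvolution {M : Type*}
    (star : (M → ℂ) → (M → ℂ) → M → ℂ → Prop) (J : (M → ℂ) → (M → ℂ)) : Prop where
  involutive : Function.Involutive J
  map_add : ∀ f g, J (f + g) = J f + J g
  map_smul : ∀ (a : ℂ) (f : M → ℂ), J (a • f) = conj a • J f
  anti_mul : ∀ f g k m, star f g m (k m) → star (J g) (J f) m (J k m)

end

namespace LieGroupoid

variable {EM EG M G : Type*}
    [NormedAddCommGroup EM] [NormedSpace ℝ EM] [NormedAddCommGroup EG] [NormedSpace ℝ EG]
    [TopologicalSpace M] [ChartedSpace EM M] [TopologicalSpace G] [ChartedSpace EG G]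

/-! ### Algebra of a groupoid and of its 2-cocycles -/

/-! Reversal `(g₂, g₁) ↦ (g₁⁻¹, g₂⁻¹)` turns the cocycle identity into minus a cocycle identity, so
`S̃` is a cocycle, and it is odd under reversal by construction.

The substance is the van Est statement. Put `c(x) = S(1_x, 1_x)` and `χ(g) = S(g, g⁻¹) - c(s(g))`.
The cocycle identity gives `S̃(g, h) = S(g, h) - c(s(g)) - (χ(g) + χ(h) - χ(gh)) / 2`
(`IsCocycle.antisymm_eq`). Differentiating in `h` at a unit kills `c(s(g))` and `χ(g)`; it kills
`χ(h)` because `dχ = 0` at units (`IsCocycle.mfderiv_primitive_unit`). What remains is half the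
derivative of `χ(gh)`. Differentiating this in `g` at `1_m`, a critical point of `χ`, gives half the
Hessian of `χ` there. Thus `R_Y R_X S` changes by a symmetric form
(`IsCocycle.exists_ROne_RTwo_antisymm`), which the alternating sum in `VE` cancels.

For the involution, reversal preserves the measure on pairs, exchanges `t(g₂)` with `s(g₁)`, and
changes the sign of `S̃`; conjugation changes the sign of `i`. The two signs compensate in the
phase. -/

theorem eq_inv_of_mul_eq_unit (Γ : LieGroupoid EM EG M G) {g h : G} (hgh : Γ.src g = Γ.tgt h)
    (H : Γ.mul g h = Γ.unit (Γ.tgt g)) : h = Γ.inv g := by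
  have h1 := Γ.mul_assoc (Γ.inv g) g h (Γ.src_inv g) hgh
  have h2 := Γ.mul_unit (Γ.inv g)
  rw [Γ.src_inv] at h2
  rwa [Γ.inv_mul, H, h2, hgh, Γ.unit_mul] at h1

theorem inv_inv (Γ : LieGroupoid EM EG M G) (g : G) : Γ.inv (Γ.inv g) = g :=
  (Γ.eq_inv_of_mul_eq_unit (Γ.src_inv g) (by rw [Γ.inv_mul, Γ.tgt_inv])).symm

theorem unit_mul_of_eq (Γ : LieGroupoid EM EG M G) {m : M} {g : G} (h : Γ.tgt g = m) :
    Γ.mul (Γ.unit m) g = g := by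
  subst h; exact Γ.unit_mul g

theorem mul_unit_of_eq (Γ : LieGroupoid EM EG M G) {m : M} {g : G} (h : Γ.src g = m) :
    Γ.mul g (Γ.unit m) = g := by
  subst h; exact Γ.mul_unit g

theorem mul_mul_inv_cancel (Γ : LieGroupoid EM EG M G) {g h : G} (hgh : Γ.src g = Γ.tgt h) :
    Γ.mul (Γ.mul g h) (Γ.inv h) = g := by
  rw [Γ.mul_assoc g h _ hgh (Γ.tgt_inv h).symm, Γ.mul_inv, ← hgh, Γ.mul_unit]

theorem inv_mul_rev (Γ : LieGroupoid EM EG M G) {g h : G} (hgh : Γ.src g = Γ.tgt h) :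
    Γ.inv (Γ.mul g h) = Γ.mul (Γ.inv h) (Γ.inv g) := by
  have hc : Γ.src (Γ.inv h) = Γ.tgt (Γ.inv g) := by rw [Γ.src_inv, Γ.tgt_inv, hgh]
  refine (Γ.eq_inv_of_mul_eq_unit ?_ ?_).symm
  · rw [Γ.src_mul _ _ hgh, Γ.tgt_mul _ _ hc, Γ.tgt_inv]
  · rw [← Γ.mul_assoc _ _ _ ?_ hc, Γ.mul_mul_inv_cancel hgh, Γ.mul_inv, Γ.tgt_mul _ _ hgh]
    rw [Γ.src_mul _ _ hgh, Γ.tgt_inv]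

theorem mul_inv_mul_rev (Γ : LieGroupoid EM EG M G) {g h : G} (hgh : Γ.src g = Γ.tgt h) :
    Γ.mul h (Γ.inv (Γ.mul g h)) = Γ.inv g := by
  have hc : Γ.src (Γ.inv h) = Γ.tgt (Γ.inv g) := by rw [Γ.src_inv, Γ.tgt_inv, hgh]
  rw [Γ.inv_mul_rev hgh, ← Γ.mul_assoc _ _ _ (Γ.tgt_inv h).symm hc, Γ.mul_inv]
  exact Γ.unit_mul_of_eq (by rw [Γ.tgt_inv, hgh])

variable {Γ : LieGroupoid EM EG M G} {S : G → G → ℝ}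

namespace IsCocycle

/-- In the cocycle identity at `(1, 1, g)` two of the three terms `S(1, g)` cancel. Since `S` need
not be normalized, the value is a function of `m`, not zero. -/
theorem apply_unit_left (hS : Γ.IsCocycle S) {m : M} {g : G} (hg : Γ.tgt g = m) :
    S (Γ.unit m) g = S (Γ.unit m) (Γ.unit m) := by
  have h := hS.2 (Γ.unit m) (Γ.unit m) g (by rw [Γ.src_unit, Γ.tgt_unit]) (by rw [Γ.src_unit, hg])
  rw [delta, Γ.unit_mul_of_eq (Γ.tgt_unit m), Γ.unit_mul_of_eq hg] at h
  linarith

theorem apply_unit_right (hS : Γ.IsCocycle S) {m : M} {g : G} (hg : Γ.src g = m) :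
    S g (Γ.unit m) = S (Γ.unit m) (Γ.unit m) := by
  have h := hS.2 g (Γ.unit m) (Γ.unit m) (by rw [Γ.tgt_unit, hg]) (by rw [Γ.src_unit, Γ.tgt_unit])
  rw [delta, Γ.unit_mul_of_eq (Γ.tgt_unit m), Γ.mul_unit_of_eq hg] at h
  linarith

end IsCocycle

/-- The 1-cochain `g ↦ S(g, g⁻¹) - S(g, 1_{s(g)})`, whose differential is, up to a function of
`s(g₂)`, the symmetrization of a 2-cocycle `S`. -/
noncomputable def primitive (Γ : LieGroupoid EM EG M G) (S : G → G → ℝ) (g : G) : ℝ :=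
  S g (Γ.inv g) - S g (Γ.unit (Γ.src g))

/-- The cocycle identities at `(g, h, (gh)⁻¹)` and `(h, h⁻¹, g⁻¹)` share the term `S(h, (gh)⁻¹)`.
Eliminating it expresses `S(g, h) + S(h⁻¹, g⁻¹)` through values on pairs `(k, k⁻¹)` and on units. -/
theorem IsCocycle.antisymm_eq (hS : Γ.IsCocycle S) {g h : G} (hgh : Γ.src g = Γ.tgt h) :
    Γ.antisymm S g h = S g h - S g (Γ.unit (Γ.src g)) -
      (Γ.primitive S g + Γ.primitive S h - Γ.primitive S (Γ.mul g h)) / 2 := by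
  have hc : Γ.src (Γ.inv h) = Γ.tgt (Γ.inv g) := by rw [Γ.src_inv, Γ.tgt_inv, hgh]
  have h1 := hS.2 g h (Γ.inv (Γ.mul g h)) hgh (by rw [Γ.tgt_inv, Γ.src_mul _ _ hgh])
  have h2 := hS.2 h (Γ.inv h) (Γ.inv g) (Γ.tgt_inv h).symm hc
  rw [delta, Γ.mul_inv_mul_rev hgh] at h1
  rw [delta, Γ.mul_inv, ← Γ.inv_mul_rev hgh,
    hS.apply_unit_left (by rw [Γ.tgt_inv, hgh])] at h2
  have h3 := hS.apply_unit_right (rfl : Γ.src h = _)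
  have h4 := hS.apply_unit_right (Γ.src_mul _ _ hgh)
  have h5 := hS.apply_unit_right hgh
  simp only [antisymm, primitive, Γ.src_mul _ _ hgh, hgh]
  linarith

theorem antisymm_reverse (S : G → G → ℝ) (g h : G) :
    Γ.antisymm S g h = -Γ.antisymm S (Γ.inv h) (Γ.inv g) := by
  simp only [antisymm, Γ.inv_inv]; ring

/-- The differential of the reversed cochain at `(g₃, g₂, g₁)` is minus that of `S` at `(g₁⁻¹, g₂⁻¹,
g₃⁻¹)`. -/
theorem IsCocycle.delta_antisymm (hS : Γ.IsCocycle S) {g₃ g₂ g₁ : G}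
    (h₃ : Γ.src g₃ = Γ.tgt g₂) (h₂ : Γ.src g₂ = Γ.tgt g₁) :
    Γ.delta (Γ.antisymm S) g₃ g₂ g₁ = 0 := by
  have h1 := hS.2 g₃ g₂ g₁ h₃ h₂
  have h2 := hS.2 (Γ.inv g₁) (Γ.inv g₂) (Γ.inv g₃) (by rw [Γ.src_inv, Γ.tgt_inv, h₂])
    (by rw [Γ.src_inv, Γ.tgt_inv, h₃])
  rw [delta, ← Γ.inv_mul_rev h₂, ← Γ.inv_mul_rev h₃] at h2
  simp only [delta, antisymm] at h1 ⊢
  linarith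

/-! ### Smoothness of cochains -/

/-- The pair `(a x, b x)` never leaves the composable pairs, so near each point `S` can be replaced
by a local smooth extension. -/
theorem IsSmoothCochain.contMDiff_comp {EN N : Type*} [NormedAddCommGroup EN] [NormedSpace ℝ EN]
    [TopologicalSpace N] [ChartedSpace EN N] (hS : Γ.IsSmoothCochain S) {a b : N → G}
    (ha : ContMDiff 𝓘(ℝ, EN) 𝓘(ℝ, EG) ∞ a) (hb : ContMDiff 𝓘(ℝ, EN) 𝓘(ℝ, EG) ∞ b)
    (hab : ∀ x, Γ.src (a x) = Γ.tgt (b x)) :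
    ContMDiff 𝓘(ℝ, EN) 𝓘(ℝ, ℝ) ∞ (fun x => S (a x) (b x)) := by
  intro x
  obtain ⟨U, F, hU, hxU, hF, hFS⟩ := hS (a x, b x) (hab x)
  have hF' := (hF.contMDiffAt (hU.mem_nhds hxU)).comp x ((ha.prodMk hb) x)
  refine hF'.congr_of_eventuallyEq ?_
  have hc := (ha.prodMk hb).continuous.continuousAt (x := x)
  filter_upwards [hc (hU.mem_nhds hxU)] with y hy
  exact (hFS (a y, b y) ⟨hy, hab y⟩).symm

theorem contMDiff_primitive (hS : Γ.IsSmoothCochain S) :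
    ContMDiff 𝓘(ℝ, EG) 𝓘(ℝ, ℝ) ∞ (Γ.primitive S) :=
  (hS.contMDiff_comp contMDiff_id Γ.smooth_inv (fun g => (Γ.tgt_inv g).symm)).sub
    (hS.contMDiff_comp contMDiff_id (Γ.smooth_unit.comp Γ.submersion_src.contMDiff)
      (fun _ => (Γ.tgt_unit _).symm))

theorem isSmoothCochain_antisymm (hS : Γ.IsSmoothCochain S) :
    Γ.IsSmoothCochain (Γ.antisymm S) := by
  rintro ⟨g, h⟩ (hgh : Γ.src g = Γ.tgt h)
  obtain ⟨U, F, hU, hxU, hF, hFS⟩ := hS (g, h) hgh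
  obtain ⟨V, F', hV, hxV, hF', hFS'⟩ := hS (Γ.inv h, Γ.inv g)
    (by simp [Γ.src_inv, Γ.tgt_inv, hgh])
  have hr : ContMDiff (𝓘(ℝ, EG).prod 𝓘(ℝ, EG)) (𝓘(ℝ, EG).prod 𝓘(ℝ, EG)) ∞
      (fun p : G × G => (Γ.inv p.2, Γ.inv p.1)) :=
    (Γ.smooth_inv.comp contMDiff_snd).prodMk (Γ.smooth_inv.comp contMDiff_fst)
  refine ⟨U ∩ (fun p : G × G => (Γ.inv p.2, Γ.inv p.1)) ⁻¹' V,
    fun p => 2⁻¹ * (F p - F' (Γ.inv p.2, Γ.inv p.1)), hU.inter (hV.preimage hr.continuous),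
    ⟨hxU, hxV⟩, ?_, ?_⟩
  · have h2 := hF'.comp (hr.contMDiffOn (s := U ∩ (fun p : G × G => (Γ.inv p.2, Γ.inv p.1)) ⁻¹' V))
      (fun p hp => hp.2)
    exact contMDiffOn_const.mul ((hF.mono Set.inter_subset_left).sub h2)
  · rintro ⟨a, b⟩ ⟨⟨h1, h2⟩, h3 : Γ.src a = Γ.tgt b⟩
    have e1 := hFS (a, b) ⟨h1, h3⟩
    have e2 := hFS' (Γ.inv b, Γ.inv a) ⟨h2, by simp [Γ.src_inv, Γ.tgt_inv, h3]⟩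
    simp only [antisymm, e1, e2]
    ring

theorem IsCocycle.antisymm (hS : Γ.IsCocycle S) : Γ.IsCocycle (Γ.antisymm S) :=
  ⟨isSmoothCochain_antisymm hS.1, fun _ _ _ h₃ h₂ => hS.delta_antisymm h₃ h₂⟩

end LieGroupoid

namespace LieGroupoid

variable {EM EG M G : Type*}
    [NormedAddCommGroup EM] [NormedSpace ℝ EM] [NormedAddCommGroup EG] [NormedSpace ℝ EG]
    [TopologicalSpace M] [ChartedSpace EM M] [TopologicalSpace G] [ChartedSpace EG G]
    {Γ : LieGroupoid EM EG M G} {S : G → G → ℝ}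

/-! ### The involution -/

theorem reversal_involutive (Γ : LieGroupoid EM EG M G) (m : M) :
    Function.Involutive (Γ.reversal m) := fun p => by
  simp [reversal, Γ.inv_inv]

variable [MeasurableSpace G] [BorelSpace G]

theorem measurable_inv (Γ : LieGroupoid EM EG M G) : Measurable Γ.inv :=
  Γ.smooth_inv.continuous.measurable

theorem measurable_invFiber (Γ : LieGroupoid EM EG M G) (m : M) : Measurable (Γ.invFiber m) :=
  (Γ.measurable_inv.comp measurable_subtype_coe).subtype_mk

theorem measurable_reversal (Γ : LieGroupoid EM EG M G) (m : M) : Measurable (Γ.reversal m) :=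
  ((Γ.measurable_inv.comp (measurable_subtype_coe.comp measurable_snd)).subtype_mk).prodMk
    ((Γ.measurable_inv.comp (measurable_subtype_coe.comp measurable_fst)).subtype_mk)

/-- Reversal is the swap followed by inversion in each factor, and inversion exchanges the two fibre
measures because one is defined as the image of the other. -/
theorem measurePreserving_reversal (Γ : LieGroupoid EM EG M G) (μ : ∀ m, Measure (Γ.SrcFiber m))
    (m : M) [SFinite (μ m)] :
    MeasurePreserving (Γ.reversal m) (Γ.pairMeasure μ m) (Γ.pairMeasure μ m) := by
  let ι : Γ.TgtFiber m → Γ.SrcFiber m := fun g => ⟨Γ.inv g.1, (Γ.src_inv g.1).trans g.2⟩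
  have hι : Measurable ι := (Γ.measurable_inv.comp measurable_subtype_coe).subtype_mk
  have hinv : MeasurePreserving (Γ.invFiber m) (μ m) ((μ m).map (Γ.invFiber m)) :=
    (Γ.measurable_invFiber m).measurePreserving _
  have hι' : MeasurePreserving ι ((μ m).map (Γ.invFiber m)) (μ m) := by
    refine ⟨hι, ?_⟩
    rw [Measure.map_map hι (Γ.measurable_invFiber m)]
    have : ι ∘ Γ.invFiber m = id := by
      funext g
      simp [ι, invFiber, Γ.inv_inv]
    rw [this, Measure.map_id]
  exact (hι'.prod hinv).comp Measure.measurePreserving_swap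

theorem measurableEmbedding_reversal (Γ : LieGroupoid EM EG M G) (m : M) :
    MeasurableEmbedding (Γ.reversal m) :=
  MeasurableEquiv.measurableEmbedding
    ⟨(Γ.reversal_involutive m).toPerm, Γ.measurable_reversal m, Γ.measurable_reversal m⟩

omit [BorelSpace G] in
theorem Exhaustion.preimage_region {m : M} (D : Γ.Exhaustion m) (n : ℕ) :
    Γ.reversal m ⁻¹' D.region n = D.region n := by
  ext p
  refine ⟨fun h => ?_, fun h => D.symmetric n p h⟩
  have := D.symmetric n _ h
  rwa [Γ.reversal_involutive m p] at this

/-- Change of variables by reversal, region by region, followed by continuity of conjugation in the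
limit. It serves both the normalizing constant and the numerator of the product. -/
theorem HasImproperIntegral.conj_reversal {μ : ∀ m, Measure (Γ.SrcFiber m)} {m : M}
    [SFinite (μ m)] {D : Γ.Exhaustion m} {F : Γ.SrcFiber m × Γ.TgtFiber m → ℂ} {c : ℂ}
    (h : Γ.HasImproperIntegral μ D F c) :
    Γ.HasImproperIntegral μ D (fun p => conj (F (Γ.reversal m p))) (conj c) := by
  have hmp := Γ.measurePreserving_reversal μ m
  have hme := Γ.measurableEmbedding_reversal m
  refine ⟨fun n => ?_, ?_⟩
  · have h1 : IntegrableOn (F ∘ Γ.reversal m) (D.region n) (Γ.pairMeasure μ m) := by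
      have := (hmp.integrableOn_comp_preimage hme).2 (h.1 n)
      rwa [D.preimage_region] at this
    exact (LinearIsometryEquiv.integrable_comp_iff Complex.conjLIE).2 h1
  · refine ((Complex.continuous_conj.tendsto c).comp h.2).congr fun n => ?_
    have h2 := hmp.setIntegral_preimage_emb hme F (D.region n)
    rw [D.preimage_region] at h2
    rw [integral_conj, h2]
    rfl

theorem HasStar.conj_anti_mul {hbar : ℝ} {μ : ∀ m, Measure (Γ.SrcFiber m)}
    {D : ∀ m, Γ.Exhaustion m} {f g : M → ℂ} {m : M} {v : ℂ} [SFinite (μ m)]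
    (hT : ∀ g₂ g₁, Γ.src g₂ = Γ.tgt g₁ → S g₂ g₁ = -S (Γ.inv g₁) (Γ.inv g₂))
    (h : Γ.HasStar S hbar μ D f g m v) :
    Γ.HasStar S hbar μ D (fun x => conj (g x)) (fun x => conj (f x)) m (conj v) := by
  obtain ⟨C, c, hC, h1, h2, rfl⟩ := h
  -- The sign of `S` under reversal compensates the sign of `i` under conjugation.
  have key (p : Γ.SrcFiber m × Γ.TgtFiber m) :
      conj (Complex.exp (Complex.I / (hbar : ℂ) *
        (S (Γ.reversal m p).1.1 (Γ.reversal m p).2.1 : ℂ))) =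
      Complex.exp (Complex.I / (hbar : ℂ) * (S p.1.1 p.2.1 : ℂ)) := by
    rw [hT p.1.1 p.2.1 (p.1.2.trans p.2.2.symm), ← Complex.exp_conj]
    congr 1
    simp [reversal, neg_div]
  refine ⟨conj C, conj c, by simpa using hC, ?_, ?_, by simp⟩
  · simpa only [key] using h1.conj_reversal
  · have h3 := h2.conj_reversal
    simp only [map_mul, key] at h3
    convert h3 using 2 with p
    simp only [reversal, Γ.src_inv, Γ.tgt_inv]
    ring

theorem isConjInvolution_conj {hbar : ℝ} {μ : ∀ m, Measure (Γ.SrcFiber m)}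
    {D : ∀ m, Γ.Exhaustion m} (hμ : ∀ m, SFinite (μ m))
    (hT : ∀ g₂ g₁, Γ.src g₂ = Γ.tgt g₁ → S g₂ g₁ = -S (Γ.inv g₁) (Γ.inv g₂)) :
    IsConjInvolution (Γ.HasStar S hbar μ D) (fun f m => conj (f m)) where
  involutive f := by simp
  map_add f g := by funext; simp
  map_smul a f := by funext; simp
  anti_mul f g k m h := by
    have := hμ m
    exact h.conj_anti_mul hT

end LieGroupoid

/-! ### Derivatives along the fibres of a submersion -/

section Fibre

variable {EM EG EN M G N : Type*}
    [NormedAddCommGroup EM] [NormedSpace ℝ EM] [NormedAddCommGroup EG] [NormedSpace ℝ EG]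
    [NormedAddCommGroup EN] [NormedSpace ℝ EN]
    [TopologicalSpace M] [ChartedSpace EM M] [TopologicalSpace G] [ChartedSpace EG G]
    [TopologicalSpace N] [ChartedSpace EN N]

/-- A vector killed by the differential of a submersion is the velocity of a curve in the fibre. -/
theorem Manifold.IsSubmersionAt.exists_curve [IsManifold 𝓘(ℝ, EM) ∞ M] [IsManifold 𝓘(ℝ, EG) ∞ G]
    {π : G → M} {p : G} (hπ : Manifold.IsSubmersionAt 𝓘(ℝ, EG) 𝓘(ℝ, EM) ∞ π p)
    {v : TangentSpace 𝓘(ℝ, EG) p} (hv : mfderiv 𝓘(ℝ, EG) 𝓘(ℝ, EM) π p v = 0) :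
    ∃ γ : ℝ → G, γ 0 = p ∧ MDifferentiableAt 𝓘(ℝ, ℝ) 𝓘(ℝ, EG) γ 0 ∧
      (mfderiv 𝓘(ℝ, ℝ) 𝓘(ℝ, EG) γ 0 (1 : ℝ) : EG) = v ∧ ∀ᶠ τ in 𝓝 0, π (γ τ) = π p := by
  set φ := hπ.domChart
  set ψ := hπ.codChart
  have hp : p ∈ φ.source := hπ.mem_domChart_source
  have hφ : MDifferentiableAt 𝓘(ℝ, EG) 𝓘(ℝ, EG) φ p :=
    ((contMDiffOn_of_mem_maximalAtlas hπ.domChart_mem_maximalAtlas).contMDiffAt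
      (φ.open_source.mem_nhds hp)).mdifferentiableAt (by simp)
  have hφ' : MDifferentiableAt 𝓘(ℝ, EG) 𝓘(ℝ, EG) φ.symm (φ p) :=
    ((contMDiffOn_symm_of_mem_maximalAtlas hπ.domChart_mem_maximalAtlas).contMDiffAt
      (φ.open_target.mem_nhds (φ.map_source hp))).mdifferentiableAt (by simp)
  have hψ : MDifferentiableAt 𝓘(ℝ, EM) 𝓘(ℝ, EM) ψ (π p) :=
    ((contMDiffOn_of_mem_maximalAtlas hπ.codChart_mem_maximalAtlas).contMDiffAt
      (ψ.open_source.mem_nhds hπ.mem_codChart_source)).mdifferentiableAt (by simp)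
  have hπd : MDifferentiableAt 𝓘(ℝ, EG) 𝓘(ℝ, EM) π p := hπ.contMDiffAt.mdifferentiableAt (by simp)
  set w : EG := mfderiv 𝓘(ℝ, EG) 𝓘(ℝ, EG) φ p v with hw
  -- In the submersion charts `π` is a linear isomorphism followed by the first projection.
  have hwr : ∀ g ∈ φ.source, ψ (π g) = (hπ.equiv (φ g)).1 := fun g hg => by
    have hmem : φ g ∈ (φ.extend 𝓘(ℝ, EG)).target := by simpa using φ.map_source hg
    have := hπ.writtenInCharts hmem
    simpa [φ.left_inv hg, φ, ψ] using this
  have hw0 : (hπ.equiv w).1 = 0 := by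
    let A : EG →L[ℝ] EM := (ContinuousLinearMap.fst ℝ EM _).comp hπ.equiv.toContinuousLinearMap
    have e : (ψ ∘ π) =ᶠ[𝓝 p] (A ∘ φ) := by
      filter_upwards [φ.open_source.mem_nhds hp] with g hg using hwr g hg
    have h1 := congrArg (fun L => L v) (e.mfderiv_eq (I := 𝓘(ℝ, EG)) (I' := 𝓘(ℝ, EM)))
    have h2 : MDifferentiableAt 𝓘(ℝ, EG) 𝓘(ℝ, EM) A (φ p) := A.differentiableAt.mdifferentiableAt
    simp only [mfderiv_comp p hψ hπd, mfderiv_comp p h2 hφ] at h1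
    have h3 : mfderiv 𝓘(ℝ, EG) 𝓘(ℝ, EM) A (φ p) w = 0 := by
      refine Eq.trans h1.symm ?_
      change mfderiv 𝓘(ℝ, EM) 𝓘(ℝ, EM) ψ (π p) (mfderiv 𝓘(ℝ, EG) 𝓘(ℝ, EM) π p v) = 0
      rw [hv, map_zero]
    rw [mfderiv_eq_fderiv, A.fderiv] at h3
    exact h3
  -- The curve is a straight line in the chart. Its direction `w` has zero first component, so the
  -- coordinates of `π` stay constant along it.
  let ℓ : ℝ → EG := fun τ => φ p + τ • w
  have hℓ : HasDerivAt ℓ w 0 := by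
    have := ((hasDerivAt_id (0 : ℝ)).smul_const w).const_add (φ p)
    rwa [one_smul] at this
  have hℓ0 : ℓ 0 = φ p := by simp [ℓ]
  have hℓm : MDifferentiableAt 𝓘(ℝ, ℝ) 𝓘(ℝ, EG) ℓ 0 := hℓ.differentiableAt.mdifferentiableAt
  rw [← hℓ0] at hφ'
  refine ⟨φ.symm ∘ ℓ, by simp [hℓ0, φ.left_inv hp], hφ'.comp 0 hℓm, ?_, ?_⟩
  · have h1 : (mfderiv 𝓘(ℝ, ℝ) 𝓘(ℝ, EG) ℓ 0 (1 : ℝ) : EG) = w := by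
      rw [mfderiv_eq_fderiv]
      exact hℓ.deriv
    rw [mfderiv_comp (0 : ℝ) hφ' hℓm]
    change (mfderiv 𝓘(ℝ, EG) 𝓘(ℝ, EG) φ.symm (ℓ 0) (mfderiv 𝓘(ℝ, ℝ) 𝓘(ℝ, EG) ℓ 0 (1 : ℝ)) : EG) = v
    erw [h1]
    have e : (φ.symm ∘ φ) =ᶠ[𝓝 p] id := by
      filter_upwards [φ.open_source.mem_nhds hp] with g hg using φ.left_inv hg
    have h2 := congrArg (fun L => (L v : EG)) (e.mfderiv_eq (I := 𝓘(ℝ, EG)) (I' := 𝓘(ℝ, EG)))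
    rw [hℓ0] at hφ' ⊢
    simp only [mfderiv_comp p hφ' hφ] at h2
    refine Eq.trans h2 ?_
    rw [mfderiv_id]; rfl
  · have hc : Tendsto ℓ (𝓝 0) (𝓝 (φ p)) := by
      have := hℓ.continuousAt.tendsto
      rwa [hℓ0] at this
    filter_upwards [hc (φ.open_target.mem_nhds (φ.map_source hp))] with τ hτ
    have hs : φ.symm (ℓ τ) ∈ φ.source := φ.map_target hτ
    refine ψ.injOn (hπ.source_subset_preimage_source hs) hπ.mem_codChart_source ?_
    have := hwr _ hs
    rw [φ.right_inv hτ] at this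
    change ψ (π (φ.symm (ℓ τ))) = ψ (π p)
    rw [this, hwr p hp]
    simp [ℓ, hw0]

/-- The derivative along a fibre of a submersion, in a direction tangent to the fibre, can be
computed with any extension off the fibre. -/
theorem Manifold.IsSubmersionAt.mfderivWithin_fibre_apply
    [IsManifold 𝓘(ℝ, EM) ∞ M] [IsManifold 𝓘(ℝ, EG) ∞ G]
    {π : G → M} {p : G} (hπ : Manifold.IsSubmersionAt 𝓘(ℝ, EG) 𝓘(ℝ, EM) ∞ π p)
    {v : TangentSpace 𝓘(ℝ, EG) p} (hv : mfderiv 𝓘(ℝ, EG) 𝓘(ℝ, EM) π p v = 0) {m : M}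
    (hm : π p = m) {f F : G → N} (hF : MDifferentiableAt 𝓘(ℝ, EG) 𝓘(ℝ, EN) F p)
    (hfF : f =ᶠ[𝓝[{h | π h = m}] p] F) :
    (mfderivWithin 𝓘(ℝ, EG) 𝓘(ℝ, EN) f {h | π h = m} p v : EN) =
      mfderiv 𝓘(ℝ, EG) 𝓘(ℝ, EN) F p v := by
  obtain ⟨γ, rfl, hγ, hγv, hγπ⟩ := hπ.exists_curve hv
  rw [hm] at hγπ
  have hfp : f (γ 0) = F (γ 0) := hfF.self_of_nhdsWithin hm
  -- Derivatives within a fibre are not unique on the whole tangent space. Along `γ`, which stays in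
  -- the fibre near `0`, the composite has a full derivative at `0`, and that one is unique.
  have hf : HasMFDerivWithinAt 𝓘(ℝ, EG) 𝓘(ℝ, EN) f {h | π h = m} (γ 0)
      (mfderivWithin 𝓘(ℝ, EG) 𝓘(ℝ, EN) f {h | π h = m} (γ 0)) :=
    (hF.mdifferentiableWithinAt.congr_of_eventuallyEq hfF hfp).hasMFDerivWithinAt
  have h1 := hf.comp (0 : ℝ) (hγ.hasMFDerivAt.hasMFDerivWithinAt (s := γ ⁻¹' {h | π h = m}))
    subset_rfl
  have h2 := h1.hasMFDerivAt hγπ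
  have h3 := hF.hasMFDerivAt.comp (0 : ℝ) hγ.hasMFDerivAt
  have ht : Tendsto γ (𝓝 0) (𝓝[{h | π h = m}] (γ 0)) :=
    tendsto_nhdsWithin_iff.2 ⟨hγ.continuousAt, hγπ⟩
  have h4 := hasMFDerivAt_unique (h2.congr_of_eventuallyEq (hfF.comp_tendsto ht).symm) h3
  have h5 := congrArg (fun L => (L (1 : ℝ) : EN)) h4
  subst hγv
  exact h5

/-- A map which is equal to `F` near `p` along the fibre of a submersion has the same
derivative as `F` in the directions tangent to the fibre. -/
theorem Manifold.IsSubmersionAt.mfderiv_eq_of_fibre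
    [IsManifold 𝓘(ℝ, EM) ∞ M] [IsManifold 𝓘(ℝ, EG) ∞ G]
    {π : G → M} {p : G} (hπ : Manifold.IsSubmersionAt 𝓘(ℝ, EG) 𝓘(ℝ, EM) ∞ π p)
    {v : TangentSpace 𝓘(ℝ, EG) p} (hv : mfderiv 𝓘(ℝ, EG) 𝓘(ℝ, EM) π p v = 0)
    {f F : G → N} (hf : MDifferentiableAt 𝓘(ℝ, EG) 𝓘(ℝ, EN) f p)
    (hF : MDifferentiableAt 𝓘(ℝ, EG) 𝓘(ℝ, EN) F p)
    (hfF : f =ᶠ[𝓝[{h | π h = π p}] p] F) :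
    (mfderiv 𝓘(ℝ, EG) 𝓘(ℝ, EN) f p v : EN) = mfderiv 𝓘(ℝ, EG) 𝓘(ℝ, EN) F p v := by
  rw [← hπ.mfderivWithin_fibre_apply hv rfl hF hfF,
    hπ.mfderivWithin_fibre_apply hv rfl hf (EventuallyEq.refl _ _)]

end Fibre

namespace LieGroupoid

variable {EM EG M G : Type*}
    [NormedAddCommGroup EM] [NormedSpace ℝ EM] [NormedAddCommGroup EG] [NormedSpace ℝ EG]
    [TopologicalSpace M] [ChartedSpace EM M] [TopologicalSpace G] [ChartedSpace EG G]
    {E' : Type*} [NormedAddCommGroup E'] [NormedSpace ℝ E']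
    {Γ : LieGroupoid EM EG M G} {S : G → G → ℝ}

/-! ### Derivatives in the second argument at the units -/

theorem contMDiff_unit_src (Γ : LieGroupoid EM EG M G) :
    ContMDiff 𝓘(ℝ, EG) 𝓘(ℝ, EG) ∞ (fun g => Γ.unit (Γ.src g)) :=
  Γ.smooth_unit.comp Γ.submersion_src.contMDiff

theorem tendsto_pair_unit_src (Γ : LieGroupoid EM EG M G) (m : M) :
    Tendsto (fun g => (g, Γ.unit (Γ.src g))) (𝓝 (Γ.unit m)) (𝓝 (Γ.unit m, Γ.unit m)) := by
  have h : Continuous (fun g => (g, Γ.unit (Γ.src g))) :=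
    continuous_id.prodMk Γ.contMDiff_unit_src.continuous
  have := h.tendsto (Γ.unit m)
  rwa [Γ.src_unit] at this

theorem inv_unit (Γ : LieGroupoid EM EG M G) (m : M) : Γ.inv (Γ.unit m) = Γ.unit m :=
  (Γ.eq_inv_of_mul_eq_unit (by rw [Γ.src_unit, Γ.tgt_unit])
    (by rw [Γ.unit_mul_of_eq (Γ.tgt_unit m), Γ.tgt_unit])).symm

variable [IsManifold 𝓘(ℝ, EG) ∞ G]

/-- The derivative of `F(g, ·)` at the unit of `s(g)` along the section `X` of the algebroid. -/
noncomputable def unitDeriv (X : Γ.AlgebroidSection) (F : G × G → E') (g : G) : E' :=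
  mfderiv 𝓘(ℝ, EG) 𝓘(ℝ, E') (fun h => F (g, h)) (Γ.unit (Γ.src g))
    (X.toFun (Γ.src g) : TangentSpace 𝓘(ℝ, EG) (Γ.unit (Γ.src g)))

theorem mdifferentiableAt_unitDeriv (X : Γ.AlgebroidSection) {F : G × G → E'} {m : M}
    (hF : ContMDiffAt (𝓘(ℝ, EG).prod 𝓘(ℝ, EG)) 𝓘(ℝ, E') ∞ F (Γ.unit m, Γ.unit m)) :
    MDifferentiableAt 𝓘(ℝ, EG) 𝓘(ℝ, E') (unitDeriv X F) (Γ.unit m) := by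
  have : IsManifold 𝓘(ℝ, EG) 1 G := .of_le (n := ∞) (by simp)
  have hη := Γ.contMDiff_unit_src.contMDiffAt (x := Γ.unit m)
  have hF' : ContMDiffAt (𝓘(ℝ, EG).prod 𝓘(ℝ, EG)) 𝓘(ℝ, E') ∞
      (Function.uncurry fun g h => F (g, h)) (Γ.unit m, Γ.unit (Γ.src (Γ.unit m))) := by
    rw [Γ.src_unit]; exact hF
  have h1 := ContMDiffAt.mfderiv (m := ∞) (fun g h => F (g, h)) (fun g => Γ.unit (Γ.src g))
    hF' hη (by simp)
  have h2 : ContMDiffAt 𝓘(ℝ, EG) 𝓘(ℝ, EG).tangent ∞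
      (fun g => (⟨Γ.unit (Γ.src g), (X.toFun (Γ.src g) :
        TangentSpace 𝓘(ℝ, EG) (Γ.unit (Γ.src g)))⟩ : TangentBundle 𝓘(ℝ, EG) G)) (Γ.unit m) :=
    (X.smooth.comp Γ.submersion_src.contMDiff).contMDiffAt
  have h3 : ContMDiffAt 𝓘(ℝ, EG) 𝓘(ℝ, E') ∞ (fun g => F (g, Γ.unit (Γ.src g))) (Γ.unit m) :=
    ContMDiffAt.comp (Γ.unit m) hF' (contMDiffAt_id.prodMk hη)
  have h4 := ContMDiffAt.clm_apply_of_inCoordinates h1 h2 h3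
  rw [Bundle.contMDiffAt_totalSpace] at h4
  exact (h4.2.mdifferentiableAt (by simp)).congr_of_eventuallyEq (by
    refine Eventually.of_forall fun g => ?_
    simp [unitDeriv]
    rfl)

/-- For `g` near `1_m` the pair `(g, 1_{s(g)})` is near `(1_m, 1_m)`, where `F` extends `S`, and `X`
is tangent to the target fibre. The equality holds on a full neighbourhood, so it can be
differentiated again. -/
theorem RTwo_eventuallyEq_unitDeriv [IsManifold 𝓘(ℝ, EM) ∞ M] (X : Γ.AlgebroidSection)
    {F : G × G → ℝ} {m : M}
    (hF : ContMDiffAt (𝓘(ℝ, EG).prod 𝓘(ℝ, EG)) 𝓘(ℝ, ℝ) ∞ F (Γ.unit m, Γ.unit m))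
    (hFS : ∀ᶠ q : G × G in 𝓝 (Γ.unit m, Γ.unit m), Γ.src q.1 = Γ.tgt q.2 → S q.1 q.2 = F q) :
    Γ.RTwo X S =ᶠ[𝓝 (Γ.unit m)] unitDeriv X F := by
  have : IsManifold 𝓘(ℝ, EG) 1 G := .of_le (n := ∞) (by simp)
  have h1 := (contMDiffAt_iff_contMDiffAt_nhds (by simp)).1
    (show ContMDiffAt (𝓘(ℝ, EG).prod 𝓘(ℝ, EG)) 𝓘(ℝ, ℝ) 1 F _ from hF.of_le (by simp))
  have ht := Γ.tendsto_pair_unit_src m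
  filter_upwards [ht.eventually h1, ht.eventually hFS.eventually_nhds] with g hg hgS
  have hd : MDifferentiableAt 𝓘(ℝ, EG) 𝓘(ℝ, ℝ) (fun h => F (g, h)) (Γ.unit (Γ.src g)) :=
    (hg.comp (Γ.unit (Γ.src g)) (contMDiffAt_const.prodMk contMDiffAt_id)).mdifferentiableAt
      (by simp)
  refine (Γ.submersion_tgt.isSubmersionAt _).mfderivWithin_fibre_apply
    (X.toFun (Γ.src g)).2 (Γ.tgt_unit _) hd ?_
  have hc : Tendsto (fun h => (g, h)) (𝓝 (Γ.unit (Γ.src g))) (𝓝 (g, Γ.unit (Γ.src g))) :=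
    (continuous_const.prodMk continuous_id).tendsto _
  filter_upwards [nhdsWithin_le_nhds (hc.eventually hgS), self_mem_nhdsWithin] with h hh ht
  exact hh ht.symm

omit [IsManifold 𝓘(ℝ, EG) ∞ G] in
theorem _root_.mfderiv_comp_graph {F : G × G → E'} {a : G → G} {p q : G} (ha : a p = q)
    (had : MDifferentiableAt 𝓘(ℝ, EG) 𝓘(ℝ, EG) a p)
    (hF : MDifferentiableAt (𝓘(ℝ, EG).prod 𝓘(ℝ, EG)) 𝓘(ℝ, E') F (p, q))
    (v : TangentSpace 𝓘(ℝ, EG) p) :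
    (mfderiv 𝓘(ℝ, EG) 𝓘(ℝ, E') (fun g => F (g, a g)) p v : E') =
      mfderiv (𝓘(ℝ, EG).prod 𝓘(ℝ, EG)) 𝓘(ℝ, E') F (p, q)
        ((v : EG), (mfderiv 𝓘(ℝ, EG) 𝓘(ℝ, EG) a p v : EG)) := by
  subst ha
  have h := hF.hasMFDerivAt.comp p
    ((hasMFDerivAt_id (I := 𝓘(ℝ, EG)) p).prodMk had.hasMFDerivAt)
  exact congrArg (fun L => (L v : E')) h.mfderiv

/-- The maps `g ↦ g⁻¹` and `g ↦ 1_{s(g)}` agree at `1_m` and have the same target, so their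
differentials there differ by a vector tangent to the target fibre. Along that fibre `S(1_m, ·)` is
constant. -/
theorem IsCocycle.mfderiv_primitive_unit [IsManifold 𝓘(ℝ, EM) ∞ M] (hS : Γ.IsCocycle S) (m : M) :
    mfderiv 𝓘(ℝ, EG) 𝓘(ℝ, ℝ) (Γ.primitive S) (Γ.unit m) = 0 := by
  obtain ⟨U, F, hU, hpU, hFU, hFS⟩ := hS.1 (Γ.unit m, Γ.unit m)
    (by rw [Set.mem_ofPred_eq, Γ.src_unit, Γ.tgt_unit])
  have hF : MDifferentiableAt (𝓘(ℝ, EG).prod 𝓘(ℝ, EG)) 𝓘(ℝ, ℝ) F (Γ.unit m, Γ.unit m) :=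
    (hFU.contMDiffAt (hU.mem_nhds hpU)).mdifferentiableAt (by simp)
  have hη0 : Γ.unit (Γ.src (Γ.unit m)) = Γ.unit m := by rw [Γ.src_unit]
  have hη : MDifferentiableAt 𝓘(ℝ, EG) 𝓘(ℝ, EG) (fun g => Γ.unit (Γ.src g)) (Γ.unit m) :=
    Γ.contMDiff_unit_src.contMDiffAt.mdifferentiableAt (by simp)
  have hι : MDifferentiableAt 𝓘(ℝ, EG) 𝓘(ℝ, EG) Γ.inv (Γ.unit m) :=
    Γ.smooth_inv.contMDiffAt.mdifferentiableAt (by simp)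
  have htgt (p : G) : MDifferentiableAt 𝓘(ℝ, EG) 𝓘(ℝ, EM) Γ.tgt p :=
    Γ.submersion_tgt.contMDiff.contMDiffAt.mdifferentiableAt (by simp)
  have hpair (a : G → G) (ha : a (Γ.unit m) = Γ.unit m)
      (had : MDifferentiableAt 𝓘(ℝ, EG) 𝓘(ℝ, EG) a (Γ.unit m)) :
      Tendsto (fun g => (g, a g)) (𝓝 (Γ.unit m)) (𝓝 (Γ.unit m, Γ.unit m)) := by
    have := (continuousAt_id.prodMk had.continuousAt).tendsto
    simpa only [id, ha] using this
  have hFd (a : G → G) (ha : a (Γ.unit m) = Γ.unit m)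
      (had : MDifferentiableAt 𝓘(ℝ, EG) 𝓘(ℝ, EG) a (Γ.unit m)) :
      MDifferentiableAt 𝓘(ℝ, EG) 𝓘(ℝ, ℝ) (fun g => F (g, a g)) (Γ.unit m) := by
    have hF0 : MDifferentiableAt (𝓘(ℝ, EG).prod 𝓘(ℝ, EG)) 𝓘(ℝ, ℝ) F (Γ.unit m, a (Γ.unit m)) := by
      rwa [ha]
    exact MDifferentiableAt.comp (Γ.unit m) hF0 (mdifferentiableAt_id.prodMk had)
  have hU' := hU.mem_nhds hpU
  have he : Γ.primitive S =ᶠ[𝓝 (Γ.unit m)]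
      (fun g => F (g, Γ.inv g) - F (g, Γ.unit (Γ.src g))) := by
    filter_upwards [hpair _ (Γ.inv_unit m) hι hU', hpair _ hη0 hη hU'] with g h1 h2
    rw [hFS (g, Γ.inv g) ⟨h1, (Γ.tgt_inv g).symm⟩,
      hFS (g, Γ.unit (Γ.src g)) ⟨h2, (Γ.tgt_unit _).symm⟩, primitive]
  have htd (a : G → G) (ha : a (Γ.unit m) = Γ.unit m) (hsrc : ∀ g, Γ.tgt (a g) = Γ.src g)
      (had : MDifferentiableAt 𝓘(ℝ, EG) 𝓘(ℝ, EG) a (Γ.unit m)) (v : EG) :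
      (mfderiv 𝓘(ℝ, EG) 𝓘(ℝ, EM) Γ.tgt (Γ.unit m)
        (mfderiv 𝓘(ℝ, EG) 𝓘(ℝ, EG) a (Γ.unit m) v : EG) : EM) =
      mfderiv 𝓘(ℝ, EG) 𝓘(ℝ, EM) Γ.src (Γ.unit m) v := by
    have key (q : G) (hq : a (Γ.unit m) = q) :
        (mfderiv 𝓘(ℝ, EG) 𝓘(ℝ, EM) Γ.tgt q
          (mfderiv 𝓘(ℝ, EG) 𝓘(ℝ, EG) a (Γ.unit m) v : EG) : EM) =
        mfderiv 𝓘(ℝ, EG) 𝓘(ℝ, EM) (Γ.tgt ∘ a) (Γ.unit m) v := by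
      subst hq
      exact (congrArg (fun L => (L v : EM)) (mfderiv_comp (Γ.unit m) (htgt _) had)).symm
    have hc : Γ.tgt ∘ a = Γ.src := funext hsrc
    rw [key _ ha, hc]
  ext v
  rw [he.mfderiv_eq]
  set A := mfderiv (𝓘(ℝ, EG).prod 𝓘(ℝ, EG)) 𝓘(ℝ, ℝ) F (Γ.unit m, Γ.unit m)
  let w₁ : EG := mfderiv 𝓘(ℝ, EG) 𝓘(ℝ, EG) Γ.inv (Γ.unit m) v
  let w₂ : EG := mfderiv 𝓘(ℝ, EG) 𝓘(ℝ, EG) (fun g => Γ.unit (Γ.src g)) (Γ.unit m) v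
  have h1 := ((hFd _ (Γ.inv_unit m) hι).hasMFDerivAt.sub (hFd _ hη0 hη).hasMFDerivAt).mfderiv
  have h2 : (A (((v : EG), w₁) : EG × EG) - A (((v : EG), w₂) : EG × EG) : ℝ) = 0 := by
    have hk : (mfderiv 𝓘(ℝ, EG) 𝓘(ℝ, EM) Γ.tgt (Γ.unit m) (w₁ - w₂ : EG) : EM) = 0 := by
      have e1 := htd _ (Γ.inv_unit m) Γ.tgt_inv hι v
      have e2 := htd _ hη0 (fun g => Γ.tgt_unit _) hη v
      exact (map_sub (mfderiv 𝓘(ℝ, EG) 𝓘(ℝ, EM) Γ.tgt (Γ.unit m)) w₁ w₂).trans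
        (sub_eq_zero.2 (e1.trans e2.symm))
    have hF2 : MDifferentiableAt 𝓘(ℝ, EG) 𝓘(ℝ, ℝ) (fun h => F (Γ.unit m, h)) (Γ.unit m) :=
      MDifferentiableAt.comp (Γ.unit m) hF (mdifferentiableAt_const.prodMk mdifferentiableAt_id)
    have hc : (mfderiv 𝓘(ℝ, EG) 𝓘(ℝ, ℝ) (fun h => F (Γ.unit m, h)) (Γ.unit m)
        (w₁ - w₂ : EG) : ℝ) = 0 := by
      refine ((Γ.submersion_tgt.isSubmersionAt (Γ.unit m)).mfderiv_eq_of_fibre hk hF2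
        (mdifferentiableAt_const (c := S (Γ.unit m) (Γ.unit m))) ?_).trans ?_
      · have hc : Tendsto (fun h => (Γ.unit m, h)) (𝓝 (Γ.unit m)) (𝓝 (Γ.unit m, Γ.unit m)) :=
          (continuous_const.prodMk continuous_id).tendsto _
        filter_upwards [nhdsWithin_le_nhds (hc hU'), self_mem_nhdsWithin] with h hh ht
        have ht' : Γ.tgt h = m := ht.trans (Γ.tgt_unit m)
        rw [hFS _ ⟨hh, by rw [Set.mem_ofPred_eq, Γ.src_unit, ht']⟩]
        exact hS.apply_unit_left ht'
      · rw [mfderiv_const]; rfl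
    have h3 := mfderiv_prod_eq_add_apply (v := ((0 : EG), (w₁ - w₂ : EG))) hF
    have h4 : (A (((0 : EG), (w₁ - w₂ : EG)) : EG × EG) : ℝ) = 0 := by
      refine h3.trans ?_
      erw [map_zero, zero_add]
      exact hc
    refine (map_sub A _ _).symm.trans (Eq.trans ?_ h4)
    congr 1
    exact Prod.ext (sub_self v) rfl
  refine Eq.trans ?_ h2
  refine (congrArg (fun L => (L v : ℝ)) h1).trans ?_
  exact congrArg₂ (fun x y : ℝ => x - y) (mfderiv_comp_graph (Γ.inv_unit m) hι hF v)
    (mfderiv_comp_graph hη0 hη hF v)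

end LieGroupoid

/-! ### Differentiation at a critical point -/

section Hessian

variable {EG G : Type*} [NormedAddCommGroup EG] [NormedSpace ℝ EG]
    [TopologicalSpace G] [ChartedSpace EG G]

/-- The derivative of `g ↦ dχ_g (V g)` at a critical point of `χ`, in a chart. -/
theorem hasMFDerivAt_fderiv_apply_of_eq_zero [IsManifold 𝓘(ℝ, EG) ∞ G] {p : G}
    {f : EG → ℝ} {V : G → EG}
    (hf : ContDiffAt ℝ ∞ f (extChartAt 𝓘(ℝ, EG) p p))
    (h0 : fderiv ℝ f (extChartAt 𝓘(ℝ, EG) p p) = 0)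
    (hV : MDifferentiableAt 𝓘(ℝ, EG) 𝓘(ℝ, EG) V p) :
    HasMFDerivAt 𝓘(ℝ, EG) 𝓘(ℝ, ℝ)
      (fun g => fderiv ℝ f (extChartAt 𝓘(ℝ, EG) p g) (V g)) p
      ((fderiv ℝ (fderiv ℝ f) (extChartAt 𝓘(ℝ, EG) p p)).flip (V p)) := by
  have : IsManifold 𝓘(ℝ, EG) 1 G := .of_le (n := ∞) (by simp)
  have hA : HasFDerivAt (fderiv ℝ f) (fderiv ℝ (fderiv ℝ f) (extChartAt 𝓘(ℝ, EG) p p))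
      (extChartAt 𝓘(ℝ, EG) p p) :=
    ((hf.fderiv_right (m := 1) (one_add_one_eq_two.trans_le ENat.LEInfty.out)).differentiableAt (by simp)).hasFDerivAt
  have he := (mdifferentiableAt_extChartAt (I := 𝓘(ℝ, EG)) (mem_chart_source EG p)).hasMFDerivAt
  rw [mfderiv_extChartAt_self] at he
  have hAe := hA.hasMFDerivAt.comp p he
  have hV' := hV.hasMFDerivAt
  have hpair : HasMFDerivAt 𝓘(ℝ, EG) 𝓘(ℝ, (EG →L[ℝ] ℝ) × EG)
      (fun g => (fderiv ℝ f (extChartAt 𝓘(ℝ, EG) p g), V g)) p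
      (ContinuousLinearMap.prod (fderiv ℝ (fderiv ℝ f) (extChartAt 𝓘(ℝ, EG) p p))
        (mfderiv 𝓘(ℝ, EG) 𝓘(ℝ, EG) V p)) :=
    ⟨hAe.1.prodMk hV'.1, hAe.2.prodMk hV'.2⟩
  have hb := (isBoundedBilinearMap_apply (𝕜 := ℝ) (E := EG) (F := ℝ)).hasFDerivAt
    (fderiv ℝ f (extChartAt 𝓘(ℝ, EG) p p), V p)
  have h := hb.hasMFDerivAt.comp p hpair
  refine h.congr_mfderiv ?_
  ext v
  refine (isBoundedBilinearMap_apply (𝕜 := ℝ) (E := EG) (F := ℝ)).deriv_apply _ _ |>.trans ?_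
  -- By the product rule the derivative of `V` enters only through `df`, which vanishes here.
  rw [h0]
  exact zero_add _

end Hessian

/-! ### Invariance of the van Est image under antisymmetrization -/

namespace LieGroupoid

variable {EM EG M G : Type*}
    [NormedAddCommGroup EM] [NormedSpace ℝ EM] [NormedAddCommGroup EG] [NormedSpace ℝ EG]
    [TopologicalSpace M] [ChartedSpace EM M] [TopologicalSpace G] [ChartedSpace EG G]
    {Γ : LieGroupoid EM EG M G} {S : G → G → ℝ}
    [IsManifold 𝓘(ℝ, EG) ∞ G] [IsManifold 𝓘(ℝ, EM) ∞ M]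

/-- Antisymmetrizing a cocycle changes the bilinear expression `R_Y R_X S` at `m` by a symmetric
bilinear form. -/
theorem IsCocycle.exists_ROne_RTwo_antisymm (hS : Γ.IsCocycle S) (m : M) :
    ∃ B : Γ.Algebroid m → Γ.Algebroid m → ℝ, (∀ v w, B v w = B w v) ∧
      ∀ X Y : Γ.AlgebroidSection, Γ.ROne Y (Γ.RTwo X (Γ.antisymm S)) m =
        Γ.ROne Y (Γ.RTwo X S) m + B (Y.toFun m) (X.toFun m) := by
  have : IsManifold 𝓘(ℝ, EG) 1 G := .of_le (n := ∞) (by simp)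
  set p := Γ.unit m with hp
  have hpp : Γ.src p = Γ.tgt p := by rw [hp, Γ.src_unit, Γ.tgt_unit]
  set e := extChartAt 𝓘(ℝ, EG) p with he
  set χ := Γ.primitive S with hχdef
  set f : EG → ℝ := χ ∘ e.symm with hfdef
  have hχ : ContMDiff 𝓘(ℝ, EG) 𝓘(ℝ, ℝ) ∞ χ := contMDiff_primitive hS.1
  have hf : ContDiffAt ℝ ∞ f (e p) := by
    rw [← contMDiffAt_iff_contDiffAt]
    have h1 := (contMDiffOn_extChartAt_symm (I := 𝓘(ℝ, EG)) (n := ∞) p).contMDiffAt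
      ((isOpen_extChartAt_target p).mem_nhds (mem_extChartAt_target p))
    exact hχ.contMDiffAt.comp (e p) h1
  have hf0 : fderiv ℝ f (e p) = 0 := by
    have hχp : MDifferentiableAt 𝓘(ℝ, EG) 𝓘(ℝ, ℝ) χ p :=
      hχ.contMDiffAt.mdifferentiableAt (by simp)
    have h1 : fderivWithin ℝ (writtenInExtChartAt 𝓘(ℝ, EG) 𝓘(ℝ, ℝ) p χ)
        (Set.range 𝓘(ℝ, EG)) (e p) = 0 :=
      hχp.mfderiv.symm.trans (hS.mfderiv_primitive_unit m)
    simpa [writtenInExtChartAt, Function.comp_def, hfdef, he, chartAt_self_eq] using h1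
  -- local extensions of the cochain and of the product
  obtain ⟨U, F, hU, hpU, hFU, hFS⟩ := hS.1 (p, p) hpp
  have hF := hFU.contMDiffAt (hU.mem_nhds hpU)
  obtain ⟨V, μ, hV, hpV, hμV, hμ⟩ := Γ.smooth_mul (p, p) hpp
  have hμd := hμV.contMDiffAt (hV.mem_nhds hpV)
  have hpmul : Γ.mul p p = p := Γ.unit_mul_of_eq (Γ.tgt_unit m)
  have hμp : μ (p, p) = p := (hμ _ ⟨hpV, hpp⟩).trans hpmul
  -- The product read in the chart at `1_m`, so that `χ(gh) = f (N (g, h))` with `f` on a vector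
  -- space.
  let N : G × G → EG := fun q => e (μ q)
  have hN : ContMDiffAt (𝓘(ℝ, EG).prod 𝓘(ℝ, EG)) 𝓘(ℝ, EG) ∞ N (p, p) :=
    (contMDiffAt_extChartAt' (I := 𝓘(ℝ, EG)) (n := ∞) (x := p) (x' := μ (p, p))
      (by rw [hμp]; exact mem_chart_source EG p)).comp (p, p) hμd
  have hNp : N (p, p) = e p := by simp only [N, hμp]
  have hmulN : ∀ᶠ q : G × G in 𝓝 (p, p), Γ.src q.1 = Γ.tgt q.2 →
      Γ.mul q.1 q.2 = e.symm (N q) := by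
    have hs : ∀ᶠ q in 𝓝 (p, p), μ q ∈ e.source := by
      refine hμd.continuousAt ?_
      rw [hμp]
      exact extChartAt_source_mem_nhds p
    filter_upwards [hs, hV.mem_nhds hpV] with q hq hqV hc
    rw [e.left_inv hq, hμ q ⟨hqV, hc⟩]
  have hNunit : ∀ᶠ g in 𝓝 p, N (g, Γ.unit (Γ.src g)) = e g := by
    filter_upwards [(Γ.tendsto_pair_unit_src m).eventually (hV.mem_nhds hpV)] with g hg
    simp only [N, hμ (g, Γ.unit (Γ.src g)) ⟨hg, (Γ.tgt_unit _).symm⟩, Γ.mul_unit]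
  have hfN : ContMDiffAt (𝓘(ℝ, EG).prod 𝓘(ℝ, EG)) 𝓘(ℝ, ℝ) ∞ (fun q => f (N q)) (p, p) := by
    refine ContMDiffAt.comp (p, p) (g := f) ?_ hN
    rw [hNp]
    exact hf.contMDiffAt
  -- A local smooth extension of `S̃`, read off from `IsCocycle.antisymm_eq`.
  let F' : G × G → ℝ := fun q => F q - S q.1 (Γ.unit (Γ.src q.1)) -
    2⁻¹ * (χ q.1 + χ q.2 - f (N q))
  have hc : ContMDiff 𝓘(ℝ, EG) 𝓘(ℝ, ℝ) ∞ (fun g => S g (Γ.unit (Γ.src g))) :=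
    hS.1.contMDiff_comp contMDiff_id Γ.contMDiff_unit_src (fun _ => (Γ.tgt_unit _).symm)
  have hF' : ContMDiffAt (𝓘(ℝ, EG).prod 𝓘(ℝ, EG)) 𝓘(ℝ, ℝ) ∞ F' (p, p) :=
    (hF.sub (hc.comp contMDiff_fst).contMDiffAt).sub (contMDiffAt_const.mul
      (((hχ.comp contMDiff_fst).contMDiffAt.add (hχ.comp contMDiff_snd).contMDiffAt).sub hfN))
  have hFS' : ∀ᶠ q : G × G in 𝓝 (p, p), Γ.src q.1 = Γ.tgt q.2 → S q.1 q.2 = F q := by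
    filter_upwards [hU.mem_nhds hpU] with q hq hcq using (hFS q ⟨hq, hcq⟩).symm
  have hFA : ∀ᶠ q : G × G in 𝓝 (p, p), Γ.src q.1 = Γ.tgt q.2 →
      Γ.antisymm S q.1 q.2 = F' q := by
    filter_upwards [hFS', hmulN] with q h1 h2 hcq
    rw [hS.antisymm_eq hcq, h1 hcq]
    simp only [F', f, Function.comp_apply, ← h2 hcq, ← hχdef]
    ring
  have hRd (X : Γ.AlgebroidSection) :
      MDifferentiableAt 𝓘(ℝ, EG) 𝓘(ℝ, EG) (unitDeriv X N) p := mdifferentiableAt_unitDeriv X hN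
  -- Terms in `g` alone are constant in `h`, and `dχ` vanishes at `1_{s(g)}`. Only `χ(gh)`
  -- contributes, by the chain rule at `N (g, 1_{s(g)}) = e g`.
  have key (X : Γ.AlgebroidSection) : unitDeriv X F' =ᶠ[𝓝 p]
      unitDeriv X F + (2⁻¹ : ℝ) • fun g => fderiv ℝ f (e g) (unitDeriv X N g) := by
    have ht := Γ.tendsto_pair_unit_src m
    have hF1 := (contMDiffAt_iff_contMDiffAt_nhds (by simp)).1
      (show ContMDiffAt (𝓘(ℝ, EG).prod 𝓘(ℝ, EG)) 𝓘(ℝ, ℝ) 1 F (p, p) from hF.of_le (by simp))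
    have hN1 := (contMDiffAt_iff_contMDiffAt_nhds (by simp)).1
      (show ContMDiffAt (𝓘(ℝ, EG).prod 𝓘(ℝ, EG)) 𝓘(ℝ, EG) 1 N (p, p) from hN.of_le (by simp))
    have hf1 : ∀ᶠ g in 𝓝 p, DifferentiableAt ℝ f (e g) := by
      have := ((hf.of_le (m := 1) (by simp)).eventually (by simp))
      filter_upwards [(continuousAt_extChartAt (I := 𝓘(ℝ, EG)) p).eventually this] with g hg
      exact hg.differentiableAt (by simp)
    filter_upwards [ht.eventually hF1, ht.eventually hN1, hf1, hNunit] with g h1 h2 h3 h4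
    set u := Γ.unit (Γ.src g)
    have hsl : ContMDiffAt 𝓘(ℝ, EG) (𝓘(ℝ, EG).prod 𝓘(ℝ, EG)) 1 (fun h : G => (g, h)) u :=
      contMDiffAt_const.prodMk contMDiffAt_id
    have d1 := ((h1.comp u hsl).mdifferentiableAt (by simp)).hasMFDerivAt
    have d2 := ((h2.comp u hsl).mdifferentiableAt (by simp)).hasMFDerivAt
    rw [← h4] at h3
    have d3 := HasMFDerivAt.comp u (h3.hasFDerivAt.hasMFDerivAt) d2
    have d4 := (hχ.contMDiffAt.mdifferentiableAt (by simp) :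
      MDifferentiableAt 𝓘(ℝ, EG) 𝓘(ℝ, ℝ) χ u).hasMFDerivAt
    rw [hS.mfderiv_primitive_unit] at d4
    have d5 := (d1.sub (hasMFDerivAt_const (S g u) u)).sub
      ((((hasMFDerivAt_const (χ g) u).add d4).sub d3).const_smul (2⁻¹ : ℝ))
    have d6 := congrArg (fun L => (L (X.toFun (Γ.src g) : TangentSpace 𝓘(ℝ, EG) u) : ℝ)) d5.mfderiv
    refine Eq.trans d6 ?_
    change ((_ : ℝ) - 0) - 2⁻¹ * ((0 + 0) - fderiv ℝ f (N (g, u)) (unitDeriv X N g)) =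
      (_ : ℝ) + 2⁻¹ * fderiv ℝ f (e g) (unitDeriv X N g)
    rw [h4, sub_zero, zero_add, zero_sub, mul_neg, sub_neg_eq_add]
    rfl
  -- Along the target fibre `N (1_m, ·)` is the chart itself, whose differential at its centre is
  -- the identity.
  have hNX (X : Γ.AlgebroidSection) :
      unitDeriv X N p = ((X.toFun m : TangentSpace 𝓘(ℝ, EG) (Γ.unit m)) : EG) := by
    -- The identity `s(1_m) = m` is only propositional; a variable base point lets it be substituted
    -- in the dependent types.
    have hfib (m' : M) (hm' : m' = m) : (mfderiv 𝓘(ℝ, EG) 𝓘(ℝ, EG) (fun h => N (p, h)) (Γ.unit m')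
        (X.toFun m' : TangentSpace 𝓘(ℝ, EG) (Γ.unit m')) : EG) =
          ((X.toFun m : TangentSpace 𝓘(ℝ, EG) (Γ.unit m)) : EG) := by
      subst hm'
      have hNd : MDifferentiableAt 𝓘(ℝ, EG) 𝓘(ℝ, EG) (fun h => N (p, h)) p :=
        (hN.comp p (contMDiffAt_const.prodMk contMDiffAt_id)).mdifferentiableAt (by simp)
      have hed : MDifferentiableAt 𝓘(ℝ, EG) 𝓘(ℝ, EG) e p :=
        mdifferentiableAt_extChartAt (mem_chart_source EG p)
      refine ((Γ.submersion_tgt.isSubmersionAt p).mfderiv_eq_of_fibre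
        (X.toFun m').2 hNd hed ?_).trans ?_
      · have hc : Tendsto (fun h => (p, h)) (𝓝 p) (𝓝 (p, p)) :=
          (continuous_const.prodMk continuous_id).tendsto _
        filter_upwards [nhdsWithin_le_nhds (hc (hV.mem_nhds hpV)), self_mem_nhdsWithin] with h hh ht
        have ht' : Γ.tgt h = m' := ht.trans (Γ.tgt_unit m')
        have hcomp : Γ.src p = Γ.tgt h := (Γ.src_unit m').trans ht'.symm
        simp only [N, hμ (p, h) ⟨hh, hcomp⟩]
        rw [hp, Γ.unit_mul_of_eq ht']
      · rw [he, mfderiv_extChartAt_self]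
        rfl
    exact hfib _ (Γ.src_unit m)
  -- The form is half the Hessian of `χ` in the chart, symmetric because second derivatives commute.
  refine ⟨fun v w => 2⁻¹ * fderiv ℝ (fderiv ℝ f) (e p)
      ((v : TangentSpace 𝓘(ℝ, EG) (Γ.unit m)) : EG) ((w : TangentSpace 𝓘(ℝ, EG) (Γ.unit m)) : EG),
    fun v w => congrArg (2⁻¹ * ·) (hf.isSymmSndFDerivAt (by simpa using ENat.LEInfty.out) _ _),
    fun X Y => ?_⟩
  have h1 := RTwo_eventuallyEq_unitDeriv X hF hFS'
  have h2 := (RTwo_eventuallyEq_unitDeriv X hF' hFA).trans (key X)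
  have d1 := (mdifferentiableAt_unitDeriv X hF).hasMFDerivAt
  have d2 := hasMFDerivAt_fderiv_apply_of_eq_zero hf hf0 (hRd X)
  have d3 := (d1.add (d2.const_smul (2⁻¹ : ℝ))).mfderiv
  rw [ROne, ROne, h1.mfderiv_eq, h2.mfderiv_eq]
  refine (congrArg (fun L => (L (Y.toFun m : TangentSpace 𝓘(ℝ, EG) (Γ.unit m)) : ℝ)) d3).trans ?_
  simp only [← hNX X]
  rfl

theorem IsCocycle.VE_antisymm (hS : Γ.IsCocycle S) (X : Fin 2 → Γ.AlgebroidSection) (m : M) :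
    Γ.VE (Γ.antisymm S) X m = Γ.VE S X m := by
  obtain ⟨B, hB, h⟩ := hS.exists_ROne_RTwo_antisymm m
  have hVE (T : G → G → ℝ) : Γ.VE T X m =
      Γ.ROne (X 1) (Γ.RTwo (X 0) T) m - Γ.ROne (X 0) (Γ.RTwo (X 1) T) m := by
    have huniv : (Finset.univ : Finset (Equiv.Perm (Fin 2))) = {1, Equiv.swap 0 1} := by decide
    rw [VE, huniv, Finset.sum_pair (by decide)]
    simp [sub_eq_add_neg]
  rw [hVE, hVE, h, h, hB ((X 1).toFun m)]
  ring

end LieGroupoid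

theorem mainTheorem7 {EM EG M G : Type*}
    [NormedAddCommGroup EM] [NormedSpace ℝ EM] [FiniteDimensional ℝ EM]
    [NormedAddCommGroup EG] [NormedSpace ℝ EG] [FiniteDimensional ℝ EG]
    [TopologicalSpace M] [T2Space M] [ChartedSpace EM M] [IsManifold 𝓘(ℝ, EM) ∞ M]
    [TopologicalSpace G] [ChartedSpace EG G] [IsManifold 𝓘(ℝ, EG) ∞ G]
    [MeasurableSpace G] [BorelSpace G]
    (Γ : LieGroupoid EM EG M G) (P : Γ.AlgebroidTwoForm)
    (S : G → G → ℝ) (hS : Γ.IsCocycle S) (hVE : Γ.VanEstEq S P) :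
    Γ.IsCocycle (Γ.antisymm S) ∧
    Γ.VanEstEq (Γ.antisymm S) P ∧
    (∀ g₂ g₁ : G, Γ.src g₂ = Γ.tgt g₁ →
      Γ.antisymm S g₂ g₁ = -Γ.antisymm S (Γ.inv g₁) (Γ.inv g₂)) ∧
    (∀ (hbar : ℝ), hbar ≠ 0 →
      ∀ (μ : ∀ m, Measure (Γ.SrcFiber m)), (∀ m, SFinite (μ m)) →
      ∀ (D : ∀ m, Γ.Exhaustion m),
        IsConjInvolution (Γ.HasStar (Γ.antisymm S) hbar μ D) (fun f m => conj (f m))) := by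
  exact ⟨hS.antisymm, fun X m => (hS.VE_antisymm X m).trans (hVE X m),
    fun g₂ g₁ _ => LieGroupoid.antisymm_reverse S g₂ g₁,
    fun _ _ _ hμ _ => LieGroupoid.isConjInvolution_conj hμ
      fun g₂ g₁ _ => LieGroupoid.antisymm_reverse S g₂ g₁⟩
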